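/- Let $X$ be a (real or complex) Banach space, let $B_X$, $B_{X^*}$ be the closed unit balls, and regard $X$ as a subspace of $X^{**}$. For a bounded sequence $(x_n)$ in $X$ and a family $\mathcal F$ of subsets of $B_{X^*}$ put $$\mathrm{ca}_{\mathcal F}(x_n)=\sup_{F\in\mathcal F}\ \inf_{N}\ \sup_{k,l\ge N}\ \sup_{x^*\in F}|x^*(x_k-x_l)|$$ (the supremum over the empty set being $0$). Write $\mathrm{ca}$, $\delta$, $\mathrm{ca}_\rho$ for $\mathrm{ca}_{\mathcal F}$ when $\mathcal F$ consists of all, all finite, respectively all weakly compact subsets of $B_{X^*}$, and let $\widetilde{\mathrm{ca}}_\rho(x_n)$ be the infimum of $\mathrm{ca}_\rho(x_{n_k})$ over all subsequences of $(x_n)$. For a nonempty bounded set $A\subset X$ let $\mathrm{wk}_X(A)=\sup\{\mathrm{dist}(z,X): z\in\overline{A}^{w^*}\}$, where $\overline{A}^{w^*}$ is the weak$^*$ closure of $A$ in $X^{**}$ and the distance is the norm distance in $X^{**}$. For a bounded linear operator $T:Y\to X$ between Banach spaces (over the same field) let $\mathrm{wk}_X(T)=\mathrm{wk}_X(T(B_Y))$,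 and let $\mathrm{cc}(T^*)$ be the supremum of $\mathrm{ca}(T^*x_n^*)$ over all weakly Cauchy sequences $(x_n^*)$ in $B_{X^*}$, where $T^*:X^*\to Y^*$ is the adjoint of $T$. Then the following assertions are equivalent: (i) There is $C>0$ such that $\mathrm{cc}(T^*)\le C\,\mathrm{wk}_X(T)$ for every bounded linear operator $T$ from any Banach space $Y$ to $X$. (ii) There is $C>0$ such that $\mathrm{cc}(T^*)\le C\,\mathrm{wk}_X(T)$ for every bounded linear operator $T:\ell_1\to X$. (iii) There is $C>0$ such that $\limsup_n|x_n^*(x_n)|\le C\,\mathrm{wk}_X(\{x_n:n\in\mathbb N\})$ whenever $(x_n)$ is a bounded sequence in $X$ and $(x_n^*)$ is a weakly null sequence in $B_{X^*}$. (iv) There is $C>0$ such that $\mathrm{ca}_\rho(x_n)\le C\,\delta(x_n)$ for every bounded sequence $(x_n)$ in $X$. (v) There is $C>0$ such that $\widetilde{\mathrm{ca}}_\rho(x_n)\le C\,\mathrm{wk}_X(\{x_n:n\in\mathbb N\})$ for every bounded sequence $(x_n)$ in $X$. -/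

import Mathlib

open Filter Topology
open scoped ENNReal NNReal

universe w u v

/-!
Quantities measuring non-Cauchyness, weak non-compactness and non-complete-continuity. All of them
take values in `[0, ∞]`, so that every supremum and infimum below is a genuine one; for bounded
sequences, bounded sets and bounded operators they are finite.
-/

namespace QuantDP

section Quantities

variable (𝕜 : Type*) [RCLike 𝕜]
variable {E : Type*} [NormedAddCommGroup E] [NormedSpace 𝕜 E]
variable {F : Type*} [NormedAddCommGroup F] [NormedSpace 𝕜 F]

/-- The seminorm `q_S(x) = sup {|f x| : f ∈ S}` of a set `S` of functionals (`0` if `S = ∅`). -/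
noncomputable def seminormOn (S : Set (StrongDual 𝕜 E)) (x : E) : ℝ≥0∞ :=
  ⨆ f ∈ S, ‖f x‖ₑ

variable (E) in
/-- All subsets of the dual unit ball. They generate the norm topology. -/
def normFamily : Set (Set (StrongDual 𝕜 E)) :=
  {S | S ⊆ Metric.closedBall 0 1}

variable (E) in
/-- The finite subsets of the dual unit ball. They generate the weak topology. -/
def weakFamily : Set (Set (StrongDual 𝕜 E)) :=
  {S | S ⊆ Metric.closedBall 0 1 ∧ S.Finite}

variable (E) in
/-- The weakly compact subsets of the dual unit ball, i.e. those compact for the weak topology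
`σ(E*, E**)`. They generate the Right topology `ρ`. -/
def rightFamily : Set (Set (StrongDual 𝕜 E)) :=
  {S | S ⊆ Metric.closedBall 0 1 ∧ IsCompact (toWeakSpace 𝕜 (StrongDual 𝕜 E) '' S)}

variable {𝕜} in
/-- The distance of a sequence from being Cauchy, uniformly on each member of the family `𝓕`:
`sup_{S ∈ 𝓕} inf_N sup_{k, l ≥ N} q_S(x_k - x_l)`. -/
noncomputable def caOn (𝓕 : Set (Set (StrongDual 𝕜 E))) (x : ℕ → E) : ℝ≥0∞ :=
  ⨆ S ∈ 𝓕, ⨅ N : ℕ, ⨆ (k : ℕ) (_ : N ≤ k) (l : ℕ) (_ : N ≤ l), seminormOn 𝕜 S (x k - x l)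

/-- `ca(x_n)`: the quantity for the norm topology. -/
noncomputable def ca (x : ℕ → E) : ℝ≥0∞ := caOn (normFamily 𝕜 E) x

/-- `δ(x_n)`: the quantity for the weak topology. -/
noncomputable def delta (x : ℕ → E) : ℝ≥0∞ := caOn (weakFamily 𝕜 E) x

/-- `ca_ρ(x_n)`: the quantity for the Right topology. -/
noncomputable def caRho (x : ℕ → E) : ℝ≥0∞ := caOn (rightFamily 𝕜 E) x

/-- The infimum of `ca_ρ` over all subsequences. -/
noncomputable def caRhoTilde (x : ℕ → E) : ℝ≥0∞ :=
  ⨅ (φ : ℕ → ℕ) (_ : StrictMono φ), caRho 𝕜 (x ∘ φ)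

/-- The weak* closure, in the bidual, of (the canonical copy of) a set `A ⊆ E`. -/
def bidualClosure (A : Set E) : Set (StrongDual 𝕜 (StrongDual 𝕜 E)) :=
  {z | StrongDual.toWeakDual z ∈ closure
    (StrongDual.toWeakDual '' (NormedSpace.inclusionInDoubleDual 𝕜 E '' A))}

/-- `wk_E(A)`: the supremum of the norm distances to (the canonical copy of) `E` of the points
of the weak* closure of `A` in the bidual. -/
noncomputable def wk (A : Set E) : ℝ≥0∞ :=
  ⨆ z ∈ bidualClosure 𝕜 A, Metric.infEDist z (Set.range (NormedSpace.inclusionInDoubleDual 𝕜 E))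

/-- A sequence is weakly Cauchy if every functional maps it to a Cauchy sequence of scalars. -/
def WeaklyCauchy (x : ℕ → E) : Prop :=
  ∀ f : StrongDual 𝕜 E, CauchySeq fun n => f (x n)

/-- A sequence is weakly null if it converges to zero in the weak topology. -/
def WeaklyNull (x : ℕ → E) : Prop :=
  Tendsto (fun n => toWeakSpace 𝕜 E (x n)) atTop (𝓝 0)

variable {𝕜}

/-- `wk(T) = wk(T(B_E))`. -/
noncomputable def wkOp (T : E →L[𝕜] F) : ℝ≥0∞ := wk 𝕜 (T '' Metric.closedBall 0 1)

/-- `cc(T)`: the supremum of `ca(T x_n)` over the weakly Cauchy sequences in the unit ball. -/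
noncomputable def cc (T : E →L[𝕜] F) : ℝ≥0∞ :=
  ⨆ (x : ℕ → E) (_ : ∀ n, x n ∈ Metric.closedBall (0 : E) 1) (_ : WeaklyCauchy 𝕜 x),
    ca 𝕜 fun n => T (x n)

/-- The Banach space adjoint `T* : F* → E*`, `T* f = f ∘ T`. -/
noncomputable def adj (T : E →L[𝕜] F) : StrongDual 𝕜 F →L[𝕜] StrongDual 𝕜 E :=
  ContinuousLinearMap.precomp 𝕜 T

end Quantities

end QuantDP

/-!
All implications rest on a quantitative form of the Eberlein–Šmulian theorem,
`QuantDP.exists_subseq_eventually_norm_sub_lt`: a bounded sequence in `X` has a subsequence whose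
weak* cluster points all lie within `6 c` of a single point of `X`, for every `c` exceeding the `wk`
of its range. Indeed, if the subsequence converges on a countable set of functionals norming the
span of the sequence, its cluster points agree there; each of them is `2 c`-close to a point of the
span, so these points are `4 c`-close to each other. In the limit case `wk = 0`, applied in `X*`,
this gives the classical Eberlein–Šmulian theorem.

The estimate `limsup |f_n(x_n)| ≤ C wk({x_n})` for weakly null `f` (`QuantDP.NullSequenceBound`) is
the hub of the argument.

* It follows from the estimate for operators on `ℓ₁`. Pass to a subsequence as above and translate,
  so that the weak* cluster points of `x` have norm at most `6 c`; the translation changes `f_n(x_n)`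
  only by a null sequence. The operator `T e_n = x_n` on `ℓ₁` then satisfies `wk(T) ≤ 12 c`: a weak*
  limit of `T a`, with `a` in the ball of `ℓ₁`, differs from `T b`, with `b` the coordinatewise
  limit of `a`, only by a contribution of the tails. This direct argument replaces the quantitative
  Krein theorem. On the other hand `limsup |f_n(x_n)| ≤ ca(T* f_n)`.
* It implies the estimate for operators on any `Y`: differences of a weakly Cauchy sequence `f` are
  weakly null, and can be tested on points `T y_n` with `y_n` in the unit ball of `Y` at which
  `T* (f_k - f_l)` is large.
* It implies `ca_ρ ≤ C δ`: by the Eberlein–Šmulian theorem, functionals taken from a weakly compact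
  set may be assumed to converge weakly, to `f₀` say; the estimate handles their differences with
  `f₀`, and `f₀` itself contributes at most `δ`.
* The inequality `ca_ρ ≤ C δ` in turn bounds the infimum of `ca_ρ` over subsequences by a multiple of
  `wk`, since the subsequence above has `δ ≤ 12 wk`; and this bound gives back the estimate for
  weakly null sequences, because such a sequence together with `0` is weakly compact.

The spaces `Y` in the first assertion range over an arbitrary universe; an isometric copy of `ℓ₁`
there gives the assertion about operators on `ℓ₁`.
-/

namespace QuantDP

/-! ### Weak convergence and the weak* closure in the bidual -/

section Bidual

variable {𝕜 : Type*} [RCLike 𝕜]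
variable {E : Type*} [NormedAddCommGroup E] [NormedSpace 𝕜 E]

lemma tendsto_toWeakSpace_iff {ι : Type*} {l : Filter ι} {x : ι → E} {x₀ : E} :
    Tendsto (fun i => toWeakSpace 𝕜 E (x i)) l (𝓝 (toWeakSpace 𝕜 E x₀)) ↔
      ∀ f : StrongDual 𝕜 E, Tendsto (fun i => f (x i)) l (𝓝 (f x₀)) := by
  rw [(NormedSpace.isEmbedding_inclusionInDoubleDualWeak 𝕜 E).tendsto_nhds_iff]
  exact tendsto_iff_forall_eval_tendsto_topDualPairing

lemma weaklyNull_iff {x : ℕ → E} :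
    WeaklyNull 𝕜 x ↔ ∀ f : StrongDual 𝕜 E, Tendsto (fun n => f (x n)) atTop (𝓝 0) := by
  have h := tendsto_toWeakSpace_iff (𝕜 := 𝕜) (l := atTop) (x := x) (x₀ := 0)
  simpa [WeaklyNull] using h

/-- Every bounded family has a weak* limit in the bidual along every ultrafilter
(Banach–Alaoglu). -/
lemma exists_bidual_limit {ι : Type*} (U : Ultrafilter ι) (g : ι → E) {M : ℝ}
    (hM : ∀ i, ‖g i‖ ≤ M) :
    ∃ z : StrongDual 𝕜 (StrongDual 𝕜 E), ∀ f : StrongDual 𝕜 E,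
      Tendsto (fun i => f (g i)) U (𝓝 (z f)) := by
  set Φ : ι → WeakDual 𝕜 (StrongDual 𝕜 E) := fun i =>
    StrongDual.toWeakDual (NormedSpace.inclusionInDoubleDual 𝕜 E (g i))
  have hmem : WeakDual.toStrongDual ⁻¹' Metric.closedBall (0 : StrongDual 𝕜 (StrongDual 𝕜 E)) M
      ∈ U.map Φ := by
    refine Filter.mem_map.2 (Filter.Eventually.of_forall fun i => ?_)
    change NormedSpace.inclusionInDoubleDual 𝕜 E (g i) ∈ Metric.closedBall _ M
    exact (mem_closedBall_zero_iff (E := StrongDual 𝕜 (StrongDual 𝕜 E))).2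
      ((NormedSpace.double_dual_bound 𝕜 E (g i)).trans (hM i))
  obtain ⟨z, -, hz⟩ := (WeakDual.isCompact_closedBall (𝕜 := 𝕜)
    (0 : StrongDual 𝕜 (StrongDual 𝕜 E)) M).ultrafilter_le_nhds' _ hmem
  refine ⟨WeakDual.toStrongDual z, fun f => ?_⟩
  have hz' : Tendsto Φ U (𝓝 z) := hz
  exact tendsto_iff_forall_eval_tendsto_topDualPairing.1 hz' f

/-- The points of the weak* closure of `g '' S` are the weak* limits of `g` along ultrafilters
that contain `S`. -/
lemma mem_bidualClosure_image {ι : Type*} {g : ι → E} {S : Set ι}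
    {z : StrongDual 𝕜 (StrongDual 𝕜 E)} :
    z ∈ bidualClosure 𝕜 (g '' S) ↔ ∃ U : Ultrafilter ι, S ∈ U ∧
      ∀ f : StrongDual 𝕜 E, Tendsto (fun i => f (g i)) U (𝓝 (z f)) := by
  have h : z ∈ bidualClosure 𝕜 (g '' S) ↔ MapClusterPt (StrongDual.toWeakDual z) (𝓟 S)
      (fun i => StrongDual.toWeakDual (NormedSpace.inclusionInDoubleDual 𝕜 E (g i))) := by
    rw [bidualClosure, Set.mem_ofPred_eq, mem_closure_iff_clusterPt, MapClusterPt, map_principal,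
      Set.image_image, Set.image_image]
  rw [h, mapClusterPt_iff_ultrafilter]
  refine exists_congr fun U => and_congr (by simp) ?_
  exact tendsto_iff_forall_eval_tendsto_topDualPairing

lemma mem_bidualClosure_range {ι : Type*} {g : ι → E} {z : StrongDual 𝕜 (StrongDual 𝕜 E)} :
    z ∈ bidualClosure 𝕜 (Set.range g) ↔ ∃ U : Ultrafilter ι,
      ∀ f : StrongDual 𝕜 E, Tendsto (fun i => f (g i)) U (𝓝 (z f)) := by
  rw [← Set.image_univ, mem_bidualClosure_image]
  exact exists_congr fun U => and_iff_right Filter.univ_mem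

lemma bidualClosure_mono {A B : Set E} (h : A ⊆ B) : bidualClosure 𝕜 A ⊆ bidualClosure 𝕜 B := by
  intro z hz
  rw [bidualClosure, Set.mem_ofPred_eq] at hz ⊢
  exact closure_mono (Set.image_mono (Set.image_mono h)) hz

lemma wk_mono {A B : Set E} (h : A ⊆ B) : wk 𝕜 A ≤ wk 𝕜 B :=
  biSup_mono fun _ hz => bidualClosure_mono h hz

lemma exists_norm_sub_lt_of_wk_lt {A : Set E} {c : ℝ} (h : wk 𝕜 A < ENNReal.ofReal c)
    {z : StrongDual 𝕜 (StrongDual 𝕜 E)} (hz : z ∈ bidualClosure 𝕜 A) :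
    ∃ x : E, ‖z - NormedSpace.inclusionInDoubleDual 𝕜 E x‖ < c := by
  have h1 : Metric.infEDist z (Set.range (NormedSpace.inclusionInDoubleDual 𝕜 E)) <
      ENNReal.ofReal c := lt_of_le_of_lt (le_biSup
        (fun z => Metric.infEDist z (Set.range (NormedSpace.inclusionInDoubleDual 𝕜 E))) hz) h
  obtain ⟨_, ⟨x, rfl⟩, hx⟩ := Metric.infEDist_lt_iff.1 h1
  refine ⟨x, ?_⟩
  rw [edist_dist, dist_eq_norm] at hx
  exact (ENNReal.ofReal_lt_ofReal_iff'.1 hx).1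

/-- To bound `wk A` by `c` it suffices to find, for each point `z` of the weak* closure, a point
of `E` whose distance to `z`, tested against the dual unit ball, is at most `c`. -/
lemma wk_le_ofReal {A : Set E} {c : ℝ} (hc : 0 ≤ c)
    (h : ∀ z ∈ bidualClosure 𝕜 A, ∃ x : E, ∀ f : StrongDual 𝕜 E, ‖f‖ ≤ 1 → ‖z f - f x‖ ≤ c) :
    wk 𝕜 A ≤ ENNReal.ofReal c := by
  refine iSup₂_le fun z hz => ?_
  obtain ⟨x, hx⟩ := h z hz
  refine (Metric.infEDist_le_edist_of_mem (Set.mem_range_self x)).trans ?_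
  rw [edist_dist, dist_eq_norm]
  refine ENNReal.ofReal_le_ofReal (ContinuousLinearMap.opNorm_le_of_unit_norm hc fun f hf => ?_)
  simpa using hx f hf.le

/-- Weakly compact sets are weak* closed in the bidual. -/
lemma wk_eq_zero_of_isCompact {A : Set E} (hA : IsCompact (toWeakSpace 𝕜 E '' A)) :
    wk 𝕜 A = 0 := by
  refine le_antisymm ?_ zero_le
  rw [← ENNReal.ofReal_zero]
  refine wk_le_ofReal le_rfl fun z hz => ?_
  rw [← Set.image_id A] at hz
  obtain ⟨U, hU, hz⟩ := mem_bidualClosure_image.1 hz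
  obtain ⟨_, ⟨x, -, rfl⟩, hx⟩ := hA.ultrafilter_le_nhds' (U.map (toWeakSpace 𝕜 E))
    (Filter.mem_map.2 (mem_of_superset hU fun a ha => Set.mem_image_of_mem _ ha))
  have hx' : Tendsto (fun a => toWeakSpace 𝕜 E a) U (𝓝 (toWeakSpace 𝕜 E x)) := hx
  refine ⟨x, fun f _ => ?_⟩
  rw [tendsto_nhds_unique (hz f) (tendsto_toWeakSpace_iff.1 hx' f), sub_self, norm_zero]

end Bidual

/-! ### A quantitative Eberlein–Šmulian theorem -/

section EberleinSmulian

variable {𝕜 : Type*} [RCLike 𝕜]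
variable {E : Type*} [NormedAddCommGroup E] [NormedSpace 𝕜 E]

/-- A separable subspace has a countable norming set of functionals. -/
lemma exists_countable_norming (S : Submodule 𝕜 E)
    (hS : TopologicalSpace.IsSeparable (S : Set E)) :
    ∃ c : Set E, c.Countable ∧ ∃ d : c → StrongDual 𝕜 E, (∀ y, ‖d y‖ ≤ 1) ∧
      ∀ v ∈ S, ∀ r : ℝ, (∀ y, ‖d y v‖ ≤ r) → ‖v‖ ≤ r := by
  obtain ⟨c, hc, hSc⟩ := hS
  choose d hd1 hd using fun y : c => exists_dual_vector'' 𝕜 (y : E)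
  refine ⟨c, hc, d, hd1, fun v hv r hr => le_of_forall_pos_le_add fun ε hε => ?_⟩
  obtain ⟨y, hy, hvy⟩ := Metric.mem_closure_iff.1 (hSc hv) (ε / 2) (half_pos hε)
  rw [dist_eq_norm] at hvy
  have h1 : ‖y‖ = ‖d ⟨y, hy⟩ y‖ := by rw [hd ⟨y, hy⟩]; simp
  have h2 : ‖d ⟨y, hy⟩ (v - y)‖ ≤ ‖v - y‖ := by
    simpa using (d ⟨y, hy⟩).le_of_opNorm_le (hd1 _) (v - y)
  have h3 : ‖d ⟨y, hy⟩ y‖ ≤ ‖d ⟨y, hy⟩ v‖ + ‖d ⟨y, hy⟩ (v - y)‖ := by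
    rw [map_sub]; exact norm_le_norm_add_norm_sub _ _
  have h4 : ‖v‖ ≤ ‖y‖ + ‖v - y‖ := norm_le_norm_add_norm_sub' _ _
  linarith [hr ⟨y, hy⟩]

/-- If `z` vanishes on the annihilator of a subspace `S`, the distance from `z` to `S` is at most
twice the distance from `z` to `E`. -/
lemma exists_mem_submodule_norm_sub_lt (S : Submodule 𝕜 E)
    {z : StrongDual 𝕜 (StrongDual 𝕜 E)}
    (hz : ∀ f : StrongDual 𝕜 E, (∀ v ∈ S, f v = 0) → z f = 0) {c : ℝ} {x : E}
    (hx : ‖z - NormedSpace.inclusionInDoubleDual 𝕜 E x‖ < c) :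
    ∃ v ∈ S, ‖z - NormedSpace.inclusionInDoubleDual 𝕜 E v‖ < 2 * c := by
  obtain ⟨g, hg1, hg⟩ := exists_dual_vector'' 𝕜 (S.mkQ x)
  -- The distance from `x` to `S` is attained by a functional annihilating `S`.
  set f : StrongDual 𝕜 E := g.toLinearMap.comp S.mkQ |>.mkContinuous 1 (fun y => by
    refine (g.le_of_opNorm_le hg1 _).trans ?_
    gcongr
    exact Submodule.Quotient.norm_mk_le S y) with hf
  have hf1 : ‖f‖ ≤ 1 := LinearMap.mkContinuous_norm_le _ zero_le_one _
  have hfx : f x = ‖S.mkQ x‖ := hg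
  have hzf : z f = 0 := hz f fun v hv => by
    have : S.mkQ v = 0 := (Submodule.Quotient.mk_eq_zero S).2 hv
    change g (S.mkQ v) = 0
    rw [this, map_zero]
  have hdist : ‖S.mkQ x‖ < c := by
    have h := (z - NormedSpace.inclusionInDoubleDual 𝕜 E x).le_of_opNorm_le_of_le le_rfl hf1
    have h' : (z - NormedSpace.inclusionInDoubleDual 𝕜 E x) f = -((‖S.mkQ x‖ : ℝ) : 𝕜) := by
      rw [sub_apply, hzf, NormedSpace.dual_def, hfx, zero_sub]
    rw [h', norm_neg, RCLike.norm_ofReal, abs_of_nonneg (norm_nonneg _), mul_one] at h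
    exact h.trans_lt hx
  obtain ⟨m, hm, hmc⟩ := Submodule.Quotient.norm_mk_lt (S.mkQ x) (sub_pos.2 hdist)
  refine ⟨x - m, ?_, ?_⟩
  · rw [← Submodule.Quotient.mk_eq_zero, Submodule.Quotient.mk_sub, hm]
    exact sub_self _
  · have : z - NormedSpace.inclusionInDoubleDual 𝕜 E (x - m) =
        (z - NormedSpace.inclusionInDoubleDual 𝕜 E x) +
          NormedSpace.inclusionInDoubleDual 𝕜 E m := by rw [map_sub]; abel
    rw [this]
    have hm' : ‖m‖ < c := by linarith
    linarith [norm_add_le (z - NormedSpace.inclusionInDoubleDual 𝕜 E x)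
      (NormedSpace.inclusionInDoubleDual 𝕜 E m), NormedSpace.double_dual_bound 𝕜 E m]

/-- **Quantitative Eberlein–Šmulian theorem.** A bounded sequence has a subsequence whose weak*
cluster points in the bidual all lie within `6 c` of a single point of `E`, for every `c` larger
than the measure of weak non-compactness of its range. -/
theorem exists_subseq_eventually_norm_sub_lt {x : ℕ → E}
    (hx : Bornology.IsBounded (Set.range x)) :
    ∃ φ : ℕ → ℕ, StrictMono φ ∧ ∀ c : ℝ, wk 𝕜 (Set.range x) < ENNReal.ofReal c →
      ∃ x₀ : E, ∀ f : StrongDual 𝕜 E, ‖f‖ ≤ 1 → ∀ᶠ n in atTop, ‖f (x (φ n) - x₀)‖ < 6 * c := by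
  obtain ⟨M, hM⟩ := hx.exists_norm_le
  replace hM : ∀ n, ‖x n‖ ≤ M := fun n => hM _ (Set.mem_range_self n)
  set S : Submodule 𝕜 E := Submodule.span 𝕜 (Set.range x)
  obtain ⟨c, hc, d, hd1, hd⟩ := exists_countable_norming S
    (TopologicalSpace.IsSeparable.span (Set.countable_range x).isSeparable)
  have : Countable c := hc.to_subtype
  -- Diagonal extraction: make the sequence converge pointwise on the countable norming set.
  have hK : IsCompact (Set.univ.pi fun _ : c => Metric.closedBall (0 : 𝕜) M) :=
    isCompact_univ_pi fun _ => isCompact_closedBall _ _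
  obtain ⟨a, -, φ, hφ, ha⟩ := hK.tendsto_subseq (x := fun n y => d y (x n)) fun n y _ => by
    rw [mem_closedBall_zero_iff]
    exact ((d y).le_of_opNorm_le (hd1 y) _).trans (by simpa using hM n)
  replace ha : ∀ y, Tendsto (fun n => d y (x (φ n))) atTop (𝓝 (a y)) := fun y =>
    tendsto_pi_nhds.1 ha y
  refine ⟨φ, hφ, fun r hr => ?_⟩
  -- Cluster points of the subsequence agree on the norming set and are `2 r`-close to `S`.
  have key : ∀ U : Ultrafilter ℕ, (U : Filter ℕ) ≤ atTop →
      ∃ z : StrongDual 𝕜 (StrongDual 𝕜 E),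
      (∀ f : StrongDual 𝕜 E, Tendsto (fun n => f (x (φ n))) U (𝓝 (z f))) ∧
      (∀ y, z (d y) = a y) ∧
      ∃ v ∈ S, ‖z - NormedSpace.inclusionInDoubleDual 𝕜 E v‖ < 2 * r := by
    intro U hU
    obtain ⟨z, hz⟩ := exists_bidual_limit (𝕜 := 𝕜) U (fun n => x (φ n)) fun n => hM _
    refine ⟨z, hz, fun y => tendsto_nhds_unique (hz (d y)) ((ha y).mono_left hU), ?_⟩
    have hzmem : z ∈ bidualClosure 𝕜 (Set.range x) :=
      bidualClosure_mono (Set.range_comp_subset_range φ x) (mem_bidualClosure_range.2 ⟨U, hz⟩)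
    obtain ⟨y, hy⟩ := exists_norm_sub_lt_of_wk_lt hr hzmem
    refine exists_mem_submodule_norm_sub_lt S (fun f hf => ?_) hy
    refine tendsto_nhds_unique (hz f) ?_
    simp_rw [fun n => hf (x (φ n)) (Submodule.subset_span (Set.mem_range_self _))]
    exact tendsto_const_nhds
  obtain ⟨z₀, -, hz₀d, x₀, hx₀, hzx₀⟩ := key (Ultrafilter.of atTop) (Ultrafilter.of_le atTop)
  refine ⟨x₀, fun f hf => ?_⟩
  by_contra hcon
  rw [not_eventually] at hcon
  have : (atTop ⊓ 𝓟 {n | ¬ ‖f (x (φ n) - x₀)‖ < 6 * r}).NeBot :=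
    frequently_mem_iff_neBot.1 hcon
  set U := Ultrafilter.of (atTop ⊓ 𝓟 {n | ¬ ‖f (x (φ n) - x₀)‖ < 6 * r})
  have hU : (U : Filter ℕ) ≤ atTop ⊓ 𝓟 {n | ¬ ‖f (x (φ n) - x₀)‖ < 6 * r} := Ultrafilter.of_le _
  obtain ⟨z, hz, hzd, v, hv, hzv⟩ := key U (hU.trans inf_le_left)
  have hge : 6 * r ≤ ‖z f - f x₀‖ := by
    refine ge_of_tendsto ((hz f).sub_const (f x₀)).norm ?_
    filter_upwards [(hU.trans inf_le_right) (mem_principal_self _)] with n hn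
    rw [← map_sub]
    exact not_lt.1 hn
  have heval : ∀ (ζ : StrongDual 𝕜 (StrongDual 𝕜 E)) (y : E) (g : StrongDual 𝕜 E), ‖g‖ ≤ 1 →
      ‖ζ g - g y‖ ≤ ‖ζ - NormedSpace.inclusionInDoubleDual 𝕜 E y‖ := fun ζ y g hg => by
    simpa using (ζ - NormedSpace.inclusionInDoubleDual 𝕜 E y).le_of_opNorm_le_of_le le_rfl hg
  have hvx : ‖v - x₀‖ ≤ 4 * r := by
    refine hd _ (S.sub_mem hv hx₀) _ fun y => ?_
    have h1 := heval z v (d y) (hd1 y)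
    have h2 := heval z₀ x₀ (d y) (hd1 y)
    rw [hzd y] at h1
    rw [hz₀d y] at h2
    have h3 : d y (v - x₀) = (a y - d y x₀) - (a y - d y v) := by rw [map_sub]; ring
    rw [h3]
    linarith [norm_sub_le (a y - d y x₀) (a y - d y v)]
  have h1 := heval z v f hf
  have h2 : ‖f (v - x₀)‖ ≤ ‖v - x₀‖ := by simpa using f.le_of_opNorm_le hf (v - x₀)
  have h3 : z f - f x₀ = (z f - f v) + f (v - x₀) := by rw [map_sub]; ring
  rw [h3] at hge
  linarith [norm_add_le (z f - f v) (f (v - x₀))]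

/-- The Eberlein–Šmulian theorem: weakly compact sets are weakly sequentially compact. -/
theorem exists_subseq_tendsto_of_isCompact {A : Set E} (hA : Bornology.IsBounded A)
    (hAc : IsCompact (toWeakSpace 𝕜 E '' A)) {x : ℕ → E} (hx : ∀ n, x n ∈ A) :
    ∃ φ : ℕ → ℕ, StrictMono φ ∧ ∃ x₀ ∈ A, ∀ f : StrongDual 𝕜 E,
      Tendsto (fun n => f (x (φ n))) atTop (𝓝 (f x₀)) := by
  have hxA : Set.range x ⊆ A := Set.range_subset_iff.2 hx
  obtain ⟨φ, hφ, h⟩ := exists_subseq_eventually_norm_sub_lt (𝕜 := 𝕜) (hA.subset hxA)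
  have hwk : wk 𝕜 (Set.range x) = 0 :=
    le_antisymm ((wk_mono hxA).trans_eq (wk_eq_zero_of_isCompact hAc)) zero_le
  set U : Ultrafilter ℕ := Ultrafilter.of atTop
  have hU : (U : Filter ℕ) ≤ atTop := Ultrafilter.of_le atTop
  obtain ⟨_, ⟨x₀, hx₀, rfl⟩, hlim⟩ := hAc.ultrafilter_le_nhds'
    (U.map fun n => toWeakSpace 𝕜 E (x (φ n)))
    (Filter.mem_map.2 (Eventually.of_forall fun n => Set.mem_image_of_mem _ (hx _)))
  have hlim' : ∀ f : StrongDual 𝕜 E, Tendsto (fun n => f (x (φ n))) U (𝓝 (f x₀)) :=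
    tendsto_toWeakSpace_iff.1 (show Tendsto _ (U : Filter ℕ) _ from hlim)
  refine ⟨φ, hφ, x₀, hx₀, ?_⟩
  -- It is enough to treat functionals of norm at most `1`.
  have hball : ∀ f : StrongDual 𝕜 E, ‖f‖ ≤ 1 →
      Tendsto (fun n => f (x (φ n))) atTop (𝓝 (f x₀)) := by
    intro f hf
    rw [Metric.tendsto_nhds]
    intro ε hε
    obtain ⟨y, hy⟩ := h (ε / 12) (by rw [hwk]; exact ENNReal.ofReal_pos.2 (by positivity))
    have hy0 : ‖f x₀ - f y‖ ≤ 6 * (ε / 12) := by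
      refine le_of_tendsto ((hlim' f).sub_const (f y)).norm ?_
      filter_upwards [hU (hy f hf)] with n hn
      rw [← map_sub]
      exact hn.le
    filter_upwards [hy f hf] with n hn
    rw [map_sub] at hn
    rw [dist_eq_norm, show f (x (φ n)) - f x₀ = (f (x (φ n)) - f y) - (f x₀ - f y) by ring]
    linarith [norm_sub_le (f (x (φ n)) - f y) (f x₀ - f y)]
  intro f
  rcases eq_or_ne f 0 with rfl | hf
  · simp
  have hf' : ((‖f‖ : ℝ) : 𝕜) ≠ 0 := by simpa using hf
  have := (hball (((‖f‖ : ℝ) : 𝕜)⁻¹ • f) (by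
    rw [norm_smul, norm_inv, RCLike.norm_ofReal, abs_norm,
      inv_mul_cancel₀ (norm_ne_zero_iff.2 hf)])).const_mul ((‖f‖ : ℝ) : 𝕜)
  simpa [mul_inv_cancel_left₀ hf'] using this

end EberleinSmulian

/-! ### The quantities `ca`, `δ` and `wk` of a sequence -/

section Quantities

/-- If `b = ∞`, the hypothesis is void and `K * b = ∞` because `K ≠ 0`. -/
lemma le_mul_of_forall_lt_ofReal {K : ℝ≥0} (hK : 0 < K) {a b : ℝ≥0∞}
    (h : ∀ c : ℝ, b < ENNReal.ofReal c → a ≤ K * ENNReal.ofReal c) : a ≤ K * b := by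
  by_contra! hlt
  have hK0 : (K : ℝ≥0∞) ≠ 0 := by exact_mod_cast hK.ne'
  have hb : b < a / K := by
    rwa [ENNReal.lt_div_iff_mul_lt (.inl hK0) (.inl ENNReal.coe_ne_top), mul_comm]
  obtain ⟨r, hbr, hra⟩ := ENNReal.lt_iff_exists_nnreal_btwn.1 hb
  rw [ENNReal.lt_div_iff_mul_lt (.inl hK0) (.inl ENNReal.coe_ne_top), mul_comm] at hra
  have := h r (by rwa [ENNReal.ofReal_coe_nnreal])
  rw [ENNReal.ofReal_coe_nnreal] at this
  exact this.not_gt hra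

lemma limsup_add_le_add {u v : ℕ → ℝ≥0∞} :
    limsup (fun n => u n + v n) atTop ≤ limsup u atTop + limsup v atTop := by
  refine ENNReal.le_of_forall_pos_le_add fun ε hε hlt => ?_
  have hε2 : (ε : ℝ≥0∞) / 2 ≠ 0 := by simpa using hε.ne'
  obtain ⟨hu, hv⟩ := ENNReal.add_lt_top.1 hlt
  refine limsup_le_of_le (h := ?_)
  filter_upwards [eventually_lt_of_limsup_lt (ENNReal.lt_add_right hu.ne hε2),
    eventually_lt_of_limsup_lt (ENNReal.lt_add_right hv.ne hε2)] with n h1 h2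
  refine (add_le_add h1.le h2.le).trans_eq ?_
  rw [add_add_add_comm, ENNReal.add_halves]

variable {𝕜 : Type*} [RCLike 𝕜]
variable {E : Type*} [NormedAddCommGroup E] [NormedSpace 𝕜 E]

lemma WeaklyNull.weaklyCauchy {x : ℕ → E} (hx : WeaklyNull 𝕜 x) : WeaklyCauchy 𝕜 x :=
  fun f => (weaklyNull_iff.1 hx f).cauchySeq

lemma WeaklyNull.comp {x : ℕ → E} (hx : WeaklyNull 𝕜 x) {φ : ℕ → ℕ}
    (hφ : Tendsto φ atTop atTop) : WeaklyNull 𝕜 (x ∘ φ) :=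
  Tendsto.comp (g := fun n => toWeakSpace 𝕜 E (x n)) hx hφ

lemma WeaklyNull.eval {f : ℕ → StrongDual 𝕜 E} (hf : WeaklyNull 𝕜 f) (x : E) :
    Tendsto (fun n => f n x) atTop (𝓝 0) :=
  weaklyNull_iff.1 hf (NormedSpace.inclusionInDoubleDual 𝕜 E x)

lemma exists_of_lt_caOn {𝓕 : Set (Set (StrongDual 𝕜 E))} {x : ℕ → E} {α : ℝ≥0∞}
    (h : α < caOn 𝓕 x) :
    ∃ S ∈ 𝓕, ∀ N, ∃ k, N ≤ k ∧ ∃ l, N ≤ l ∧ ∃ f ∈ S, α < ‖f (x k - x l)‖ₑ := by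
  simp only [caOn, seminormOn, lt_iSup_iff] at h
  obtain ⟨S, hS, h⟩ := h
  refine ⟨S, hS, fun N => ?_⟩
  have := h.trans_le (iInf_le _ N)
  simpa only [lt_iSup_iff, exists_prop] using this

lemma exists_of_caOn_lt {𝓕 : Set (Set (StrongDual 𝕜 E))} {x : ℕ → E} {r : ℝ≥0∞}
    (h : caOn 𝓕 x < r) {S : Set (StrongDual 𝕜 E)} (hS : S ∈ 𝓕) :
    ∃ N, ∀ k, N ≤ k → ∀ l, N ≤ l → ∀ f ∈ S, ‖f (x k - x l)‖ₑ < r := by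
  have h1 := (le_biSup (fun S => ⨅ N : ℕ, ⨆ (k : ℕ) (_ : N ≤ k) (l : ℕ) (_ : N ≤ l),
    seminormOn 𝕜 S (x k - x l)) hS).trans_lt h
  obtain ⟨N, hN⟩ := iInf_lt_iff.1 h1
  refine ⟨N, fun k hk l hl f hf => lt_of_le_of_lt ?_ hN⟩
  exact (le_biSup (fun f : StrongDual 𝕜 E => ‖f (x k - x l)‖ₑ) hf).trans
    ((le_biSup (fun l => seminormOn 𝕜 S (x k - x l)) hl).trans
      (le_biSup (fun k => ⨆ (l : ℕ) (_ : N ≤ l), seminormOn 𝕜 S (x k - x l)) hk))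

lemma enorm_apply_le {f : StrongDual 𝕜 E} (hf : f ∈ Metric.closedBall (0 : StrongDual 𝕜 E) 1)
    (x : E) : ‖f x‖ₑ ≤ ‖x‖ₑ := by
  rw [enorm_le_iff_norm_le]
  simpa using f.le_of_opNorm_le (mem_closedBall_zero_iff.1 hf) x

/-- The quantity `ca` only depends on the norms of the differences of the sequence. -/
lemma ca_eq (x : ℕ → E) :
    ca 𝕜 x = ⨅ N : ℕ, ⨆ (k : ℕ) (_ : N ≤ k) (l : ℕ) (_ : N ≤ l), ‖x k - x l‖ₑ := by
  refine le_antisymm (iSup₂_le fun S hS => ?_) ?_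
  · gcongr
    exact iSup₂_le fun f hf => enorm_apply_le (hS hf) _
  · refine le_trans ?_ (le_biSup (fun S => ⨅ N : ℕ, ⨆ (k : ℕ) (_ : N ≤ k) (l : ℕ) (_ : N ≤ l),
      seminormOn 𝕜 S (x k - x l)) (show Metric.closedBall (0 : StrongDual 𝕜 E) 1 ∈ normFamily 𝕜 E
      from fun _ h => h))
    gcongr with N k _ l _
    obtain ⟨f, hf, hfx⟩ := exists_dual_vector'' 𝕜 (x k - x l)
    refine le_trans (le_of_eq ?_) (le_biSup (fun f : StrongDual 𝕜 E => ‖f (x k - x l)‖ₑ)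
      (mem_closedBall_zero_iff.2 hf))
    simp only [hfx]
    rw [← enorm_norm, ← enorm_norm ((‖x k - x l‖ : ℝ) : 𝕜), RCLike.norm_ofReal, abs_norm]

lemma delta_le_of_eventually {x : ℕ → E} {x₀ : E} {r : ℝ}
    (h : ∀ f : StrongDual 𝕜 E, ‖f‖ ≤ 1 → ∀ᶠ n in atTop, ‖f (x n - x₀)‖ < r) :
    delta 𝕜 x ≤ ENNReal.ofReal (2 * r) := by
  refine iSup₂_le fun S hS => ?_
  obtain ⟨N, hN⟩ := eventually_atTop.1 ((eventually_all_finite hS.2).2 fun f hf =>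
    h f (mem_closedBall_zero_iff.1 (hS.1 hf)))
  refine (iInf_le _ N).trans (iSup₂_le fun k hk => iSup₂_le fun l hl => iSup₂_le fun f hf => ?_)
  rw [← ofReal_norm]
  refine ENNReal.ofReal_le_ofReal ?_
  rw [show x k - x l = (x k - x₀) - (x l - x₀) by abel, map_sub]
  linarith [norm_sub_le (f (x k - x₀)) (f (x l - x₀)), hN k hk f hf, hN l hl f hf]

lemma exists_of_delta_lt {x : ℕ → E} {r : ℝ≥0∞} (h : delta 𝕜 x < r) {f : StrongDual 𝕜 E}
    (hf : ‖f‖ ≤ 1) : ∃ N, ∀ k, N ≤ k → ∀ l, N ≤ l → ‖f (x k - x l)‖ₑ < r := by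
  obtain ⟨N, hN⟩ := exists_of_caOn_lt h (S := {f})
    ⟨Set.singleton_subset_iff.2 (mem_closedBall_zero_iff.2 hf), Set.finite_singleton f⟩
  exact ⟨N, fun k hk l hl => hN k hk l hl f rfl⟩

/-- The terms of a sequence do not contribute to `wk`, so `wk` is controlled by the asymptotic
behaviour of the sequence under the functionals of the dual unit ball. -/
lemma wk_range_le_ofReal {y : ℕ → E} {d : ℝ} (hd : 0 ≤ d)
    (h : ∀ f : StrongDual 𝕜 E, ‖f‖ ≤ 1 → ∀ᶠ n in atTop, ‖f (y n)‖ ≤ d) :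
    wk 𝕜 (Set.range y) ≤ ENNReal.ofReal d := by
  refine wk_le_ofReal hd fun z hz => ?_
  obtain ⟨U, hU⟩ := mem_bidualClosure_range.1 hz
  rcases U.le_cofinite_or_eq_pure with hcof | ⟨n, hn⟩
  · refine ⟨0, fun f hf => ?_⟩
    rw [map_zero, sub_zero]
    rw [Nat.cofinite_eq_atTop] at hcof
    exact le_of_tendsto (hU f).norm (hcof (h f hf))
  · refine ⟨y n, fun f _ => ?_⟩
    have h1 := hU f
    rw [hn, Ultrafilter.coe_pure] at h1
    rw [tendsto_nhds_unique h1 (tendsto_pure_nhds _ _), sub_self, norm_zero]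
    exact hd

lemma wk_range_sub_le_delta {x y : ℕ → E} {k l : ℕ → ℕ} (hk : ∀ n, n ≤ k n) (hl : ∀ n, n ≤ l n)
    (hy : ∀ n, y n = x (k n) - x (l n)) : wk 𝕜 (Set.range y) ≤ delta 𝕜 x := by
  have h := le_mul_of_forall_lt_ofReal one_pos (a := wk 𝕜 (Set.range y)) (b := delta 𝕜 x)
    fun d hd => ?_
  · simpa using h
  rw [ENNReal.coe_one, one_mul]
  have hd0 : 0 < d := ENNReal.ofReal_pos.1 (zero_le.trans_lt hd)
  refine wk_range_le_ofReal hd0.le fun f hf => ?_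
  obtain ⟨N, hN⟩ := exists_of_delta_lt hd hf
  filter_upwards [eventually_ge_atTop N] with n hn
  have := hN (k n) (hn.trans (hk n)) (l n) (hn.trans (hl n))
  rw [← ofReal_norm, ENNReal.ofReal_lt_ofReal_iff hd0] at this
  rw [hy]
  exact this.le

end Quantities

/-! ### Operators on `ℓ₁` -/

section LOne

variable {𝕜 : Type*} [RCLike 𝕜]
variable {E : Type*} [NormedAddCommGroup E] [NormedSpace 𝕜 E]

lemma hasSum_norm_lp_one (a : lp (fun _ : ℕ => 𝕜) 1) : HasSum (fun n => ‖a n‖) ‖a‖ := by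
  simpa using lp.hasSum_norm (p := 1) (by simp) a

/-- A bounded sequence `x` in a Banach space defines an operator on `ℓ₁` mapping the unit vectors
to the terms of `x`. -/
lemma exists_lp_one_operator [CompleteSpace E] {x : ℕ → E}
    (hx : Bornology.IsBounded (Set.range x)) :
    ∃ T : lp (fun _ : ℕ => 𝕜) 1 →L[𝕜] E, ∀ a, HasSum (fun n => a n • x n) (T a) := by
  obtain ⟨M, hM⟩ := hx.exists_norm_le
  replace hM : ∀ n, ‖x n‖ ≤ M := fun n => hM _ (Set.mem_range_self n)
  have hle : ∀ (a : lp (fun _ : ℕ => 𝕜) 1) n, ‖a n • x n‖ ≤ ‖a n‖ * M := fun a n => by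
    rw [norm_smul]
    gcongr
    exact hM n
  have hs : ∀ a : lp (fun _ : ℕ => 𝕜) 1, Summable fun n => a n • x n := fun a =>
    .of_norm_bounded ((hasSum_norm_lp_one a).summable.mul_right M) (hle a)
  let T : lp (fun _ : ℕ => 𝕜) 1 →ₗ[𝕜] E :=
    { toFun := fun a => ∑' n, a n • x n
      map_add' := fun a b => by
        simp only [lp.coeFn_add, Pi.add_apply, add_smul]
        exact (hs a).tsum_add (hs b)
      map_smul' := fun c a => by
        simp only [lp.coeFn_smul, Pi.smul_apply, smul_assoc, RingHom.id_apply]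
        exact (hs a).tsum_const_smul c }
  refine ⟨T.mkContinuous M fun a => ?_, fun a => (hs a).hasSum⟩
  rw [mul_comm]
  exact tsum_of_norm_bounded ((hasSum_norm_lp_one a).mul_right M) (hle a)

lemma apply_single_of_hasSum {x : ℕ → E} {T : lp (fun _ : ℕ => 𝕜) 1 →L[𝕜] E}
    (hT : ∀ a, HasSum (fun n => a n • x n) (T a)) (k : ℕ) : T (lp.single 1 k 1) = x k := by
  refine (hT _).unique ?_
  convert hasSum_single k fun n hn => ?_ using 1
  · simp
  · rw [lp.single_apply_ne _ _ _ hn, zero_smul]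

/-- Every ultrafilter on the unit ball of `ℓ₁` converges coordinatewise to a point of the ball. -/
lemma exists_coordinatewise_limit
    (U : Ultrafilter (Metric.closedBall (0 : lp (fun _ : ℕ => 𝕜) 1) 1)) :
    ∃ b : lp (fun _ : ℕ => 𝕜) 1, ‖b‖ ≤ 1 ∧
      ∀ n, Tendsto (fun a : Metric.closedBall (0 : lp (fun _ : ℕ => 𝕜) 1) 1 => a.1 n) U
        (𝓝 (b n)) := by
  have hball : ∀ a : Metric.closedBall (0 : lp (fun _ : ℕ => 𝕜) 1) 1, ‖a.1‖ ≤ 1 := fun a =>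
    mem_closedBall_zero_iff.1 a.2
  have hlim : ∀ n, ∃ t : 𝕜,
      Tendsto (fun a : Metric.closedBall (0 : lp (fun _ : ℕ => 𝕜) 1) 1 => a.1 n) U (𝓝 t) := by
    intro n
    obtain ⟨t, -, ht⟩ := (isCompact_closedBall (0 : 𝕜) 1).ultrafilter_le_nhds'
      (U.map fun a : Metric.closedBall (0 : lp (fun _ : ℕ => 𝕜) 1) 1 => a.1 n)
      (Filter.mem_map.2 (Eventually.of_forall fun a => mem_closedBall_zero_iff.2
        ((lp.norm_apply_le_norm one_ne_zero a.1 n).trans (hball a))))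
    exact ⟨t, ht⟩
  choose b hb using hlim
  have hpi : Tendsto (id fun a : Metric.closedBall (0 : lp (fun _ : ℕ => 𝕜) 1) 1 =>
      (a.1 : ℕ → 𝕜)) U (𝓝 b) := tendsto_pi_nhds.2 hb
  have hmem : Memℓp b 1 := lp.memℓp_of_tendsto (E := fun _ : ℕ => 𝕜)
    (Metric.isBounded_closedBall.subset
      (by rintro _ ⟨a, rfl⟩; exact a.2 :
        Set.range Subtype.val ⊆ Metric.closedBall (0 : lp (fun _ : ℕ => 𝕜) 1) 1)) hpi
  exact ⟨⟨b, hmem⟩, lp.norm_le_of_tendsto (Eventually.of_forall hball) hpi, hb⟩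

/-- If the functionals of the dual unit ball are eventually at most `r` on the sequence `x`, the
operator on `ℓ₁` defined by `x` satisfies `wk(T) ≤ 2 r`: if `z` is a weak* limit of `T a` and `b`
is the coordinatewise limit of `a`, the coordinates of `a - b` with small index do not contribute
to `z - T b`, while the other ones contribute at most `r ‖a - b‖ ≤ 2 r`. -/
lemma wkOp_le_ofReal {x : ℕ → E} (hx : Bornology.IsBounded (Set.range x))
    {T : lp (fun _ : ℕ => 𝕜) 1 →L[𝕜] E} (hT : ∀ a, HasSum (fun n => a n • x n) (T a))
    {r : ℝ} (hr : 0 ≤ r)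
    (h : ∀ f : StrongDual 𝕜 E, ‖f‖ ≤ 1 → ∀ᶠ n in atTop, ‖f (x n)‖ ≤ r) :
    wkOp T ≤ ENNReal.ofReal (2 * r) := by
  obtain ⟨M, hM⟩ := hx.exists_norm_le
  replace hM : ∀ n, ‖x n‖ ≤ M := fun n => hM _ (Set.mem_range_self n)
  rw [wkOp, Set.image_eq_range]
  refine wk_le_ofReal (by positivity) fun z hz => ?_
  obtain ⟨U, hU⟩ := mem_bidualClosure_range.1 hz
  obtain ⟨b, hb1, hb⟩ := exists_coordinatewise_limit U
  refine ⟨T b, fun f hf => ?_⟩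
  obtain ⟨N, hN⟩ := eventually_atTop.1 (h f hf)
  have hfM : ∀ n, ‖f (x n)‖ ≤ M := fun n =>
    (f.le_of_opNorm_le hf (x n)).trans (by simpa using hM n)
  have hbound : ∀ d : lp (fun _ : ℕ => 𝕜) 1, ‖f (T d)‖ ≤
      ∑ n ∈ Finset.range N, ‖d n‖ * M + ‖d‖ * r := by
    intro d
    have h1 : HasSum (fun n => d n * f (x n)) (f (T d)) := by
      simpa using (hT d).mapL f
    have h2 : HasSum (fun n => (if n ∈ Finset.range N then ‖d n‖ * M else 0) + ‖d n‖ * r)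
        (∑ n ∈ Finset.range N, ‖d n‖ * M + ‖d‖ * r) := by
      refine HasSum.add ?_ ((hasSum_norm_lp_one d).mul_right r)
      have h3 : HasSum (fun n => if n ∈ Finset.range N then ‖d n‖ * M else 0)
          (∑ n ∈ Finset.range N, if n ∈ Finset.range N then ‖d n‖ * M else 0) :=
        hasSum_sum_of_ne_finset_zero fun n hn => if_neg hn
      rwa [Finset.sum_congr rfl fun n hn => if_pos hn] at h3
    rw [← h1.tsum_eq]
    refine tsum_of_norm_bounded h2 fun n => ?_
    rw [norm_mul]
    split_ifs with hn
    · have : 0 ≤ ‖d n‖ * r := by positivity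
      linarith [mul_le_mul_of_nonneg_left (hfM n) (norm_nonneg (d n))]
    · rw [zero_add]
      exact mul_le_mul_of_nonneg_left (hN n (by simpa using hn)) (norm_nonneg _)
  have hlim : Tendsto (fun a : Metric.closedBall (0 : lp (fun _ : ℕ => 𝕜) 1) 1 =>
      ∑ n ∈ Finset.range N, ‖a.1 n - b n‖ * M + 2 * r) U
      (𝓝 (∑ n ∈ Finset.range N, ‖b n - b n‖ * M + 2 * r)) :=
    (tendsto_finsetSum _ fun n _ => (((hb n).sub_const (b n)).norm.mul_const M)).add_const _
  simp only [sub_self, norm_zero, zero_mul, Finset.sum_const_zero, zero_add] at hlim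
  refine le_of_tendsto_of_tendsto' ((hU f).sub_const (f (T b))).norm hlim fun a => ?_
  rw [← map_sub, ← map_sub]
  refine (hbound (a.1 - b)).trans ?_
  have ha : ‖a.1 - b‖ ≤ 2 :=
    (norm_sub_le _ _).trans (by linarith [mem_closedBall_zero_iff.1 a.2])
  have hM0 : 0 ≤ M := (norm_nonneg _).trans (hM 0)
  gcongr
  exact le_rfl

end LOne

/-! ### From weakly null sequences to adjoint operators and to the Right topology -/

section Implications

variable {𝕜 : Type*} [RCLike 𝕜]
variable {X : Type*} [NormedAddCommGroup X] [NormedSpace 𝕜 X]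

variable (𝕜 X) in
/-- The estimate `limsup |f_n(x_n)| ≤ C wk({x_n})` for bounded sequences `x` in `X` and weakly null
sequences `f` in the dual unit ball: a quantitative Dunford–Pettis property of `X`. -/
def NullSequenceBound (C : ℝ≥0) : Prop :=
  ∀ (x : ℕ → X) (f : ℕ → StrongDual 𝕜 X), Bornology.IsBounded (Set.range x) →
    (∀ n, f n ∈ Metric.closedBall (0 : StrongDual 𝕜 X) 1) → WeaklyNull 𝕜 f →
    limsup (fun n => ‖f n (x n)‖ₑ) atTop ≤ C * wk 𝕜 (Set.range x)

/-- The differences of two sequences of functionals of norm at most `1` have norm at most `2`;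
hence this form of the estimate. -/
lemma NullSequenceBound.limsup_le {C : ℝ≥0} (hC : NullSequenceBound 𝕜 X C) {x : ℕ → X}
    (hx : Bornology.IsBounded (Set.range x)) {f : ℕ → StrongDual 𝕜 X} (hf : ∀ n, ‖f n‖ ≤ 2)
    (hnull : ∀ g : StrongDual 𝕜 (StrongDual 𝕜 X), Tendsto (fun n => g (f n)) atTop (𝓝 0)) :
    limsup (fun n => ‖f n (x n)‖ₑ) atTop ≤ 2 * C * wk 𝕜 (Set.range x) := by
  have h := hC x (fun n => (2⁻¹ : 𝕜) • f n) hx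
    (fun n => by
      rw [mem_closedBall_zero_iff, norm_smul, norm_inv, RCLike.norm_ofNat]
      linarith [hf n])
    (weaklyNull_iff.2 fun g => by simpa using (hnull g).const_mul (2⁻¹ : 𝕜))
  have h2 : (fun n => ‖f n (x n)‖ₑ) = fun n => 2 * ‖((2⁻¹ : 𝕜) • f n) (x n)‖ₑ := by
    funext n
    have : (2 : ℝ≥0∞) = ‖(2 : 𝕜)‖ₑ := by
      rw [← ofReal_norm, RCLike.norm_ofNat, ENNReal.ofReal_ofNat]
    rw [this, ← enorm_mul, smul_apply, smul_eq_mul, mul_inv_cancel_left₀ two_ne_zero]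
  rw [h2, ENNReal.limsup_const_mul_of_ne_top (by simp), mul_assoc]
  gcongr

theorem NullSequenceBound.cc_adj_le {C : ℝ≥0} (hC : NullSequenceBound 𝕜 X C)
    {Y : Type*} [NormedAddCommGroup Y] [NormedSpace 𝕜 Y] (T : Y →L[𝕜] X) :
    cc (adj T) ≤ (2 * C : ℝ≥0) * wkOp T := by
  refine iSup₂_le fun f hf => iSup_le fun hcauchy =>
    ENNReal.le_of_forall_nnreal_lt fun α hα => ?_
  obtain ⟨S, hS, h⟩ := exists_of_lt_caOn hα
  choose k hk l hl g hg hlt using h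
  have hy : ∀ n, ∃ y : Y, ‖y‖ ≤ 1 ∧ (α : ℝ≥0∞) < ‖(f (k n) - f (l n)) (T y)‖ₑ := by
    intro n
    have h1 := (hlt n).trans_le (enorm_apply_le (hS (hg n)) _)
    obtain ⟨y, hy1, hy⟩ := ContinuousLinearMap.exists_lt_apply_of_lt_opNNNorm _
      (ENNReal.coe_lt_coe.1 h1)
    refine ⟨y, by exact_mod_cast hy1.le, ?_⟩
    rw [← map_sub] at hy
    exact ENNReal.coe_lt_coe.2 hy
  choose y hy1 hy using hy
  have hrange : Set.range (fun n => T (y n)) ⊆ T '' Metric.closedBall 0 1 := by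
    rintro _ ⟨n, rfl⟩
    exact Set.mem_image_of_mem _ (mem_closedBall_zero_iff.2 (hy1 n))
  have hbdd : Bornology.IsBounded (T '' Metric.closedBall 0 1) :=
    T.lipschitz.isBounded_image Metric.isBounded_closedBall
  have htop : ∀ {m : ℕ → ℕ}, (∀ n, n ≤ m n) → Tendsto m atTop atTop := fun hm =>
    tendsto_atTop_mono hm tendsto_id
  have hlim := hC.limsup_le (hbdd.subset hrange) (f := fun n => f (k n) - f (l n))
    (fun n => (norm_sub_le _ _).trans (by
      linarith [mem_closedBall_zero_iff.1 (hf (k n)), mem_closedBall_zero_iff.1 (hf (l n))]))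
    (fun g => by
      obtain ⟨t, ht⟩ := cauchySeq_tendsto_of_complete (hcauchy g)
      simpa using (ht.comp (htop hk)).sub (ht.comp (htop hl)))
  calc (α : ℝ≥0∞) ≤ limsup (fun n => ‖(f (k n) - f (l n)) (T (y n))‖ₑ) atTop :=
        le_limsup_of_frequently_le (Frequently.of_forall fun n => (hy n).le)
    _ ≤ 2 * C * wk 𝕜 (Set.range fun n => T (y n)) := hlim
    _ ≤ (2 * C : ℝ≥0) * wkOp T := by
        push_cast
        gcongr
        exact wk_mono hrange

/-- A weakly compact set of functionals on which the sequence is not uniformly Cauchy yields, by the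
Eberlein–Šmulian theorem, functionals `f n → f₀` weakly and differences `y n` of the sequence
with `f n (y n)` large; here `(f n - f₀) (y n)` is controlled by `wk({y n}) ≤ δ` and `f₀ (y n)`
by `δ`. -/
theorem NullSequenceBound.caRho_le {C : ℝ≥0} (hC : NullSequenceBound 𝕜 X C)
    {x : ℕ → X} (hx : Bornology.IsBounded (Set.range x)) :
    caRho 𝕜 x ≤ (2 * C + 1 : ℝ≥0) * delta 𝕜 x := by
  refine le_of_forall_lt_imp_le_of_dense fun α hα => ?_
  obtain ⟨S, ⟨hS1, hS⟩, h⟩ := exists_of_lt_caOn hα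
  choose k hk l hl f hf hlt using h
  obtain ⟨φ, hφ, f₀, hf₀, hlim⟩ := exists_subseq_tendsto_of_isCompact
    (Metric.isBounded_closedBall.subset hS1) hS hf
  have hf₀1 : ‖f₀‖ ≤ 1 := mem_closedBall_zero_iff.1 (hS1 hf₀)
  set y : ℕ → X := fun n => x (k (φ n)) - x (l (φ n)) with hy
  have hkφ : ∀ n, n ≤ k (φ n) := fun n => (hφ.id_le n).trans (hk _)
  have hlφ : ∀ n, n ≤ l (φ n) := fun n => (hφ.id_le n).trans (hl _)
  have hybdd : Bornology.IsBounded (Set.range y) := (hx.sub hx).subset <| by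
    rintro _ ⟨n, rfl⟩
    exact Set.sub_mem_sub (Set.mem_range_self _) (Set.mem_range_self _)
  have h1 : limsup (fun n => ‖(f (φ n) - f₀) (y n)‖ₑ) atTop ≤ 2 * C * wk 𝕜 (Set.range y) :=
    hC.limsup_le hybdd (fun n => (norm_sub_le _ _).trans (by
      linarith [mem_closedBall_zero_iff.1 (hS1 (hf (φ n)))]))
      (fun g => by simpa using (hlim g).sub_const (g f₀))
  have h2 : limsup (fun n => ‖f₀ (y n)‖ₑ) atTop ≤ delta 𝕜 x := by
    refine le_of_forall_gt_imp_ge_of_dense fun r hr => ?_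
    obtain ⟨N, hN⟩ := exists_of_delta_lt hr hf₀1
    refine limsup_le_of_le (h := ?_)
    filter_upwards [eventually_ge_atTop N] with n hn
    exact (hN _ (hn.trans (hkφ n)) _ (hn.trans (hlφ n))).le
  calc α ≤ limsup (fun n => ‖f (φ n) (y n)‖ₑ) atTop :=
        le_limsup_of_frequently_le (Frequently.of_forall fun n => (hlt (φ n)).le)
    _ ≤ limsup (fun n => ‖(f (φ n) - f₀) (y n)‖ₑ + ‖f₀ (y n)‖ₑ) atTop := by
        refine limsup_le_limsup (Eventually.of_forall fun n => ?_)
        refine le_trans (le_of_eq ?_) (enorm_add_le _ _)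
        rw [sub_apply, sub_add_cancel]
    _ ≤ _ := limsup_add_le_add
    _ ≤ 2 * C * delta 𝕜 x + delta 𝕜 x := by
        gcongr
        exact h1.trans (mul_le_mul_right (wk_range_sub_le_delta hkφ hlφ fun _ => rfl) _)
    _ = (2 * C + 1 : ℝ≥0) * delta 𝕜 x := by push_cast; ring

/-- The quantitative Eberlein–Šmulian theorem in terms of `δ`. -/
theorem exists_subseq_delta_le {x : ℕ → X} (hx : Bornology.IsBounded (Set.range x)) :
    ∃ φ : ℕ → ℕ, StrictMono φ ∧ delta 𝕜 (x ∘ φ) ≤ (12 : ℝ≥0) * wk 𝕜 (Set.range x) := by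
  obtain ⟨φ, hφ, h⟩ := exists_subseq_eventually_norm_sub_lt (𝕜 := 𝕜) hx
  refine ⟨φ, hφ, le_mul_of_forall_lt_ofReal (by norm_num) fun c hc => ?_⟩
  obtain ⟨x₀, hx₀⟩ := h c hc
  refine (delta_le_of_eventually (x := x ∘ φ) hx₀).trans_eq ?_
  rw [show 2 * (6 * c) = 12 * c by ring, ENNReal.ofReal_mul (by norm_num)]
  simp

theorem caRhoTilde_le_of_caRho_le {C : ℝ≥0}
    (hC : ∀ x : ℕ → X, Bornology.IsBounded (Set.range x) → caRho 𝕜 x ≤ C * delta 𝕜 x)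
    {x : ℕ → X} (hx : Bornology.IsBounded (Set.range x)) :
    caRhoTilde 𝕜 x ≤ (C * 12 : ℝ≥0) * wk 𝕜 (Set.range x) := by
  obtain ⟨φ, hφ, h⟩ := exists_subseq_delta_le (𝕜 := 𝕜) hx
  calc caRhoTilde 𝕜 x ≤ caRho 𝕜 (x ∘ φ) := iInf₂_le φ hφ
    _ ≤ C * delta 𝕜 (x ∘ φ) := hC _ (hx.subset (Set.range_comp_subset_range φ x))
    _ ≤ C * ((12 : ℝ≥0) * wk 𝕜 (Set.range x)) := by gcongr
    _ = _ := by rw [ENNReal.coe_mul, mul_assoc]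

/-- The set formed by a weakly null sequence and `0` belongs to the family that generates the
Right topology. -/
lemma insert_zero_range_mem_rightFamily {f : ℕ → StrongDual 𝕜 X}
    (hf : ∀ n, f n ∈ Metric.closedBall (0 : StrongDual 𝕜 X) 1) (hnull : WeaklyNull 𝕜 f) :
    insert 0 (Set.range f) ∈ rightFamily 𝕜 X := by
  refine ⟨Set.insert_subset (by simp) (Set.range_subset_iff.2 hf), ?_⟩
  rw [Set.image_insert_eq, map_zero, ← Set.range_comp]
  exact Tendsto.isCompact_insert_range (f := fun n => toWeakSpace 𝕜 (StrongDual 𝕜 X) (f n)) hnull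

theorem nullSequenceBound_of_caRhoTilde_le {C : ℝ≥0}
    (hC : ∀ x : ℕ → X, Bornology.IsBounded (Set.range x) →
      caRhoTilde 𝕜 x ≤ C * wk 𝕜 (Set.range x)) :
    NullSequenceBound 𝕜 X C := by
  intro x f hx hf hnull
  refine le_of_forall_lt_imp_le_of_dense fun α hα => ?_
  obtain ⟨φ, hφ, hαφ⟩ := extraction_of_frequently_atTop 
    (frequently_lt_of_lt_limsup (by isBoundedDefault) hα)
  have hφx := Set.range_comp_subset_range φ x
  refine le_of_forall_gt_imp_ge_of_dense fun r hr => ?_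
  have h1 : caRhoTilde 𝕜 (x ∘ φ) < r :=
    ((hC _ (hx.subset hφx)).trans (mul_le_mul_right (wk_mono hφx) _)).trans_lt hr
  obtain ⟨ψ, h1⟩ := iInf_lt_iff.1 h1
  obtain ⟨hψ, h1⟩ := iInf_lt_iff.1 h1
  obtain ⟨N, hN⟩ := exists_of_caOn_lt h1 (insert_zero_range_mem_rightFamily hf hnull)
  set y : ℕ → X := x ∘ φ ∘ ψ
  set g : ℕ → StrongDual 𝕜 X := f ∘ φ ∘ ψ
  have hg : Tendsto (fun n => ‖g n (y N)‖ₑ) atTop (𝓝 0) := by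
    simpa using (WeaklyNull.eval (f := g) (hnull.comp (hφ.comp hψ).tendsto_atTop) (y N)).enorm
  have hlim : Tendsto (fun n => r + ‖g n (y N)‖ₑ) atTop (𝓝 (r + 0)) := tendsto_const_nhds.add hg
  rw [add_zero] at hlim
  refine ge_of_tendsto hlim ?_
  filter_upwards [eventually_ge_atTop N] with n hn
  calc α ≤ ‖g n (y n)‖ₑ := (hαφ (ψ n)).le
    _ = ‖g n (y n - y N) + g n (y N)‖ₑ := by rw [map_sub, sub_add_cancel]
    _ ≤ ‖g n (y n - y N)‖ₑ + ‖g n (y N)‖ₑ := enorm_add_le _ _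
    _ ≤ r + ‖g n (y N)‖ₑ := by
        gcongr
        exact (hN n hn N le_rfl (g n) (Set.mem_insert_of_mem _ (Set.mem_range_self _))).le

end Implications

/-! ### From operators on `ℓ₁` to weakly null sequences -/

section OperatorsOnLOne

variable {𝕜 : Type*} [RCLike 𝕜]
variable {X : Type*} [NormedAddCommGroup X] [NormedSpace 𝕜 X]

/-- Evaluation at the unit vectors of `ℓ₁` bounds `ca(T* f_n)` from below: `T* f_l` tends to zero on
each unit vector `e_k`, so `‖T* f_k - T* f_l‖` is asymptotically at least `|f_k(x_k)|`. -/
lemma limsup_le_cc_adj {x : ℕ → X} {T : lp (fun _ : ℕ => 𝕜) 1 →L[𝕜] X}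
    (hT : ∀ a, HasSum (fun n => a n • x n) (T a)) {f : ℕ → StrongDual 𝕜 X}
    (hf : ∀ n, f n ∈ Metric.closedBall (0 : StrongDual 𝕜 X) 1) (hnull : WeaklyNull 𝕜 f) :
    limsup (fun n => ‖f n (x n)‖ₑ) atTop ≤ cc (adj T) := by
  refine le_trans ?_ (le_iSup₂_of_le f hf (le_iSup_of_le hnull.weaklyCauchy le_rfl))
  rw [ca_eq]
  refine le_iInf fun N => limsup_le_of_le (h := ?_)
  filter_upwards [eventually_ge_atTop N] with k hk
  refine le_iSup₂_of_le k hk ?_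
  have hlim : Tendsto (fun l => ‖f k (x k) - f l (x k)‖ₑ) atTop (𝓝 ‖f k (x k) - 0‖ₑ) :=
    ((hnull.eval (x k)).const_sub _).enorm
  rw [sub_zero] at hlim
  refine le_of_tendsto hlim ?_
  filter_upwards [eventually_ge_atTop N] with l hl
  refine le_iSup₂_of_le l hl ?_
  have h1 : f k (x k) - f l (x k) = (adj T (f k) - adj T (f l)) (lp.single 1 k 1) := by
    rw [← apply_single_of_hasSum hT k]
    rfl
  rw [h1, enorm_le_iff_norm_le]
  refine (ContinuousLinearMap.le_opNorm _ _).trans_eq ?_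
  rw [lp.norm_single zero_lt_one, norm_one, mul_one]

/-- After passing to a subsequence and translating, the weak* cluster points of `x` have norm of the
order of `wk({x n})`, and `x` defines an operator `T` on `ℓ₁` with `wk(T)` of the same order. -/
theorem nullSequenceBound_of_cc_adj_le [CompleteSpace X] {C : ℝ≥0} (hC0 : 0 < C)
    (hC : ∀ T : lp (fun _ : ℕ => 𝕜) 1 →L[𝕜] X, cc (adj T) ≤ C * wkOp T) :
    NullSequenceBound 𝕜 X (C * 12) := by
  intro x f hx hf hnull
  refine le_mul_of_forall_lt_ofReal (by positivity) fun c hc =>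
    le_of_forall_lt_imp_le_of_dense fun α hα => ?_
  obtain ⟨φ, hφ, hαφ⟩ := extraction_of_frequently_atTop 
    (frequently_lt_of_lt_limsup (by isBoundedDefault) hα)
  have hφx := Set.range_comp_subset_range φ x
  obtain ⟨ψ, hψ, h⟩ := exists_subseq_eventually_norm_sub_lt (𝕜 := 𝕜) (hx.subset hφx)
  obtain ⟨x₀, hx₀⟩ := h c ((wk_mono hφx).trans_lt hc)
  have hc0 : 0 < c := ENNReal.ofReal_pos.1 (zero_le.trans_lt hc)
  set y : ℕ → X := fun n => x (φ (ψ n)) - x₀ with hy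
  set g : ℕ → StrongDual 𝕜 X := f ∘ φ ∘ ψ with hg
  have hgnull : WeaklyNull 𝕜 g := hnull.comp (hφ.comp hψ).tendsto_atTop
  have hybdd : Bornology.IsBounded (Set.range y) :=
    (hx.sub (Bornology.isBounded_singleton (x := x₀))).subset <| by
      rintro _ ⟨n, rfl⟩
      exact Set.sub_mem_sub (Set.mem_range_self _) rfl
  obtain ⟨T, hT⟩ := exists_lp_one_operator (𝕜 := 𝕜) hybdd
  have hwk : wkOp T ≤ ENNReal.ofReal (2 * (6 * c)) :=
    wkOp_le_ofReal hybdd hT (by positivity) fun f hf => (hx₀ f hf).mono fun n hn => hn.le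
  have hg0 : limsup (fun n => ‖g n x₀‖ₑ) atTop = 0 := by
    have : Tendsto (fun n => ‖g n x₀‖ₑ) atTop (𝓝 0) := by simpa using (hgnull.eval x₀).enorm
    exact this.limsup_eq
  calc α ≤ limsup (fun n => ‖g n (y n) + g n x₀‖ₑ) atTop := by
        refine le_limsup_of_frequently_le (Frequently.of_forall fun n => ?_)
        rw [hy, map_sub, sub_add_cancel]
        exact (hαφ (ψ n)).le
    _ ≤ limsup (fun n => ‖g n (y n)‖ₑ + ‖g n x₀‖ₑ) atTop :=
        limsup_le_limsup (Eventually.of_forall fun n => enorm_add_le _ _)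
    _ ≤ limsup (fun n => ‖g n (y n)‖ₑ) atTop + limsup (fun n => ‖g n x₀‖ₑ) atTop :=
        limsup_add_le_add
    _ ≤ cc (adj T) := by
        rw [hg0, add_zero]
        exact limsup_le_cc_adj hT (fun n => hf _) hgnull
    _ ≤ C * ENNReal.ofReal (2 * (6 * c)) := (hC T).trans (mul_le_mul_right hwk _)
    _ = (C * 12 : ℝ≥0) * ENNReal.ofReal c := by
        rw [show 2 * (6 * c) = 12 * c by ring, ENNReal.ofReal_mul (by norm_num), ENNReal.coe_mul,
          mul_assoc]
        simp

/-- The quantity `cc(T*)` does not change when the domain of `T` is replaced by an isometric copy. -/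
lemma cc_adj_comp_linearIsometryEquiv {Y Z : Type*} [NormedAddCommGroup Y] [NormedSpace 𝕜 Y]
    [NormedAddCommGroup Z] [NormedSpace 𝕜 Z] (T : Z →L[𝕜] X) (e : Y ≃ₗᵢ[𝕜] Z) :
    cc (adj (T ∘L (e.toContinuousLinearEquiv : Y →L[𝕜] Z))) = cc (adj T) := by
  have h : ∀ f : StrongDual 𝕜 X,
      ‖adj (T ∘L (e.toContinuousLinearEquiv : Y →L[𝕜] Z)) f‖ₑ = ‖adj T f‖ₑ := fun f => by
    rw [← ofReal_norm, ← ofReal_norm]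
    exact congrArg ENNReal.ofReal ((f ∘L T).opNorm_comp_linearIsometryEquiv e)
  simp only [cc, ca_eq, ← map_sub, h]

lemma wkOp_comp_linearIsometryEquiv_le {Y Z : Type*} [NormedAddCommGroup Y] [NormedSpace 𝕜 Y]
    [NormedAddCommGroup Z] [NormedSpace 𝕜 Z] (T : Z →L[𝕜] X) (e : Y ≃ₗᵢ[𝕜] Z) :
    wkOp (T ∘L (e.toContinuousLinearEquiv : Y →L[𝕜] Z)) ≤ wkOp T := by
  refine wk_mono ?_
  rintro _ ⟨y, hy, rfl⟩
  refine ⟨e y, ?_, rfl⟩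
  rw [mem_closedBall_zero_iff] at hy ⊢
  rwa [e.norm_map]

variable (𝕜) in
/-- The scalars embed into `ℝ × ℝ`, so `ℓ₁` has an isometric copy in every universe. -/
lemma small_lp_one : Small.{v} (lp (fun _ : ℕ => 𝕜) 1) := by
  have : Small.{v} 𝕜 := small_of_injective (β := ℝ × ℝ)
    (f := fun z : 𝕜 => (RCLike.re z, RCLike.im z)) fun a b h =>
      RCLike.ext (congrArg Prod.fst h) (congrArg Prod.snd h)
  exact small_of_injective (β := ℕ → 𝕜) (f := fun a => a) Subtype.val_injective

/-- An estimate for all operators whose domain lies in a fixed universe gives the estimate for the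
operators on `ℓ₁`. -/
theorem cc_adj_le_of_forall_domain {C : ℝ≥0}
    (hC : ∀ (Y : Type v) [NormedAddCommGroup Y] [NormedSpace 𝕜 Y] [CompleteSpace Y]
      (T : Y →L[𝕜] X), cc (adj T) ≤ C * wkOp T)
    (T : lp (fun _ : ℕ => 𝕜) 1 →L[𝕜] X) : cc (adj T) ≤ C * wkOp T := by
  have := small_lp_one.{v} 𝕜
  let e : Shrink.{v} (lp (fun _ : ℕ => 𝕜) 1) ≃ₗᵢ[𝕜] lp (fun _ : ℕ => 𝕜) 1 :=
    { Shrink.linearEquiv 𝕜 (lp (fun _ : ℕ => 𝕜) 1) with norm_map' := fun _ => rfl }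
  have : CompleteSpace (Shrink.{v} (lp (fun _ : ℕ => 𝕜) 1)) :=
    (completeSpace_congr (e := e.toEquiv) e.isometry.isUniformEmbedding).2 inferInstance
  rw [← cc_adj_comp_linearIsometryEquiv T e]
  refine (hC _ _).trans ?_
  gcongr
  exact wkOp_comp_linearIsometryEquiv_le T e

end OperatorsOnLOne

end QuantDP

theorem theorem4p5 {𝕜 : Type w} [RCLike 𝕜]
    {X : Type u} [NormedAddCommGroup X] [NormedSpace 𝕜 X] [CompleteSpace X] :
    List.TFAE [
      ∃ C : ℝ≥0, 0 < C ∧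
        ∀ (Y : Type v) [NormedAddCommGroup Y] [NormedSpace 𝕜 Y] [CompleteSpace Y]
          (T : Y →L[𝕜] X), QuantDP.cc (QuantDP.adj T) ≤ C * QuantDP.wkOp T,
      ∃ C : ℝ≥0, 0 < C ∧
        ∀ T : lp (fun _ : ℕ => 𝕜) 1 →L[𝕜] X,
          QuantDP.cc (QuantDP.adj T) ≤ C * QuantDP.wkOp T,
      ∃ C : ℝ≥0, 0 < C ∧
        ∀ (x : ℕ → X) (f : ℕ → StrongDual 𝕜 X), Bornology.IsBounded (Set.range x) →
          (∀ n, f n ∈ Metric.closedBall (0 : StrongDual 𝕜 X) 1) → QuantDP.WeaklyNull 𝕜 f →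
          limsup (fun n => ‖f n (x n)‖ₑ) atTop ≤ C * QuantDP.wk 𝕜 (Set.range x),
      ∃ C : ℝ≥0, 0 < C ∧
        ∀ x : ℕ → X, Bornology.IsBounded (Set.range x) →
          QuantDP.caRho 𝕜 x ≤ C * QuantDP.delta 𝕜 x,
      ∃ C : ℝ≥0, 0 < C ∧
        ∀ x : ℕ → X, Bornology.IsBounded (Set.range x) →
          QuantDP.caRhoTilde 𝕜 x ≤ C * QuantDP.wk 𝕜 (Set.range x)] := by
  tfae_have 1 → 2 := fun ⟨C, hC0, hC⟩ => ⟨C, hC0, QuantDP.cc_adj_le_of_forall_domain hC⟩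
  tfae_have 2 → 3 := fun ⟨C, hC0, hC⟩ =>
    ⟨C * 12, by positivity, QuantDP.nullSequenceBound_of_cc_adj_le hC0 hC⟩
  tfae_have 3 → 1 := fun ⟨C, hC0, hC⟩ =>
    ⟨2 * C, by positivity, fun Y _ _ _ T => QuantDP.NullSequenceBound.cc_adj_le hC T⟩
  tfae_have 3 → 4 := fun ⟨C, _, hC⟩ =>
    ⟨2 * C + 1, by positivity, fun _ hx => QuantDP.NullSequenceBound.caRho_le hC hx⟩
  tfae_have 4 → 5 := fun ⟨C, hC0, hC⟩ =>
    ⟨C * 12, by positivity, fun _ hx => QuantDP.caRhoTilde_le_of_caRho_le hC hx⟩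
  tfae_have 5 → 3 := fun ⟨C, hC0, hC⟩ =>
    ⟨C, hC0, QuantDP.nullSequenceBound_of_caRhoTilde_le hC⟩
  tfae_finish
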